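/- Let $d\ge 1$, let $\alpha>0$ and let $\|\cdot\|$ be any norm on $\mathbb{R}^d$. Let $R$ be a non-negative random variable with distribution function $F$, and let $Z=(Z_1,\dots,Z_d)$ be a random vector in $\mathbb{R}^d$ independent of $R$. Assume that at least one of the following two conditions holds: (i) the tail function $1-F$ is regularly varying at infinity with index $-\alpha$, i.e. $\lim_{u\to\infty}\frac{1-F(ux)}{1-F(u)}=x^{-\alpha}$ for all $x>0$, and $\mathbb{E}[\|Z\|^{\alpha+\varepsilon}]<\infty$ for some $\varepsilon>0$; (ii) $1-F(x)\sim Cx^{-\alpha}$ as $x\to\infty$ for some $C>0$, and $\mathbb{E}[\|Z\|^{\alpha}]<\infty$. Let $M_0(\mathbb{R}^d)$ be the set of Borel measures $\mu$ on $\mathbb{R}^d\setminus\{0\}$ such that $\mu(\mathbb{R}^d\setminus O)<\infty$ for every open neighbourhood $O$ of $0$. For $\mu_n,\mu\in M_0(\mathbb{R}^d)$ write $\mu_n\stackrel{M_0}{\longrightarrow}\mu$ if $\int f\,\mathrm{d}\mu_n\to\int f\,\mathrm{d}\mu$ for every bounded continuous function $f:\mathbb{R}^d\to\mathbb{R}$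 that vanishes on a neighbourhood of $0$. Let $a_n=\inf\{x\in\mathbb{R}:F(x)\ge 1-1/n\}$ be the quantile of order $1-1/n$ of $R$. Then $a_n\to+\infty$, and the product $X=RZ$ satisfies \[ n\,\mathbb{P}(a_n^{-1}X\in\cdot)\stackrel{M_0}{\longrightarrow}\Lambda(\cdot)\quad\text{as } n\to\infty, \] where the limit measure $\Lambda\in M_0(\mathbb{R}^d)$ is given by \[ \Lambda(A)=\int_0^\infty \mathbb{P}(uZ\in A)\,\alpha u^{-\alpha-1}\,\mathrm{d}u,\qquad A\subset\mathbb{R}^d\setminus\{0\}\ \text{Borel}, \] and is homogeneous of order $\alpha$: $\Lambda(vA)=v^{-\alpha}\Lambda(A)$ for all $v>0$ and all Borel $A\subset\mathbb{R}^d\setminus\{0\}$. If moreover $\mathbb{P}(Z\neq 0)>0$, then $\Lambda\neq 0$, so that $X$ is regularly varying with normalizing sequence $(a_n)$, limit measure $\Lambda$ and index $\alpha$. Finally, if $Z$ has almost surely non-negative components, then $\Lambda$ is supported by $[0,\infty)^d\setminus\{0\}$, i.e. $\Lambda$ gives no mass to the complement of this set, and for every $x\in[0,\infty)^d\setminus\{0\}$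 \[ V(x):=\Lambda\big([0,\infty)^d\setminus[0,x]\big)=\mathbb{E}\left[\max_{1\le i\le d}\left(\frac{Z_i}{x_i}\right)^{\alpha}\right]\in[0,\infty], \] where $[0,x]=[0,x_1]\times\cdots\times[0,x_d]$, $t/0=+\infty$ for $t>0$ and $0/0=0$. -/

import Mathlib

open MeasureTheory ProbabilityTheory Filter Topology

namespace RegVar

/-- `g : ℝ → ℝ` is regularly varying at infinity with index `ρ`:
`g (u x) / g u → x ^ ρ` as `u → ∞`, for every `x > 0`. -/
def RegularlyVaryingAtTop (g : ℝ → ℝ) (ρ : ℝ) : Prop :=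
  ∀ x : ℝ, 0 < x → Tendsto (fun u : ℝ => g (u * x) / g u) atTop (𝓝 (x ^ ρ))

/-- The tail function `1 - F` of a real random variable `R` with distribution function `F`. -/
noncomputable def tail {Ω : Type*} [MeasurableSpace Ω] (P : Measure Ω) (R : Ω → ℝ) (x : ℝ) : ℝ :=
  1 - cdf (P.map R) x

/-- The quantile of order `p` of a real random variable `R`: `F^←(p) = inf {x | F x ≥ p}`. -/
noncomputable def quantile {Ω : Type*} [MeasurableSpace Ω] (P : Measure Ω) (R : Ω → ℝ) (p : ℝ) :
    ℝ :=
  sInf {x : ℝ | p ≤ cdf (P.map R) x}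

/-- Membership in `M₀(ℝ^d)`. A Borel measure on `ℝ^d ∖ {0}` is represented by the Borel measure on
`ℝ^d` that extends it and gives no mass to the origin; it must be finite outside every open
neighbourhood of the origin. -/
structure IsM0 {d : ℕ} (μ : Measure (Fin d → ℝ)) : Prop where
  zero : μ {0} = 0
  finite : ∀ O : Set (Fin d → ℝ), IsOpen O → 0 ∈ O → μ Oᶜ < ⊤

/-- `M₀`-convergence: all measures belong to `M₀(ℝ^d)` and `∫ f dμₙ → ∫ f dμ` for every bounded
continuous `f` that vanishes on a neighbourhood of the origin. -/
structure TendstoM0 {d : ℕ} (μs : ℕ → Measure (Fin d → ℝ)) (μ : Measure (Fin d → ℝ)) : Prop where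
  mem : ∀ n, IsM0 (μs n)
  mem_lim : IsM0 μ
  tendsto : ∀ f : BoundedContinuousFunction (Fin d → ℝ) ℝ, (∀ᶠ x in 𝓝 0, f x = 0) →
    Tendsto (fun n => ∫ x, f x ∂(μs n)) atTop (𝓝 (∫ x, f x ∂μ))

/-- The measure `n P(X / a ∈ ·)` on `ℝ^d ∖ {0}`. -/
noncomputable def scaledLaw {Ω : Type*} [MeasurableSpace Ω] {d : ℕ} (P : Measure Ω)
    (X : Ω → Fin d → ℝ) (n : ℕ) (a : ℝ) : Measure (Fin d → ℝ) :=
  (n : ENNReal) • (P.map (fun ω => a⁻¹ • X ω)).restrict {0}ᶜ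

/-- `X` is regularly varying with normalizing sequence `a` and limit measure `Λ`. -/
structure IsRegularlyVarying {Ω : Type*} [MeasurableSpace Ω] {d : ℕ} (P : Measure Ω)
    (X : Ω → Fin d → ℝ) (a : ℕ → ℝ) (Λ : Measure (Fin d → ℝ)) : Prop where
  tendsto_atTop : Tendsto a atTop atTop
  tendstoM0 : TendstoM0 (fun n => scaledLaw P X n (a n)) Λ
  ne_zero : Λ ≠ 0

/-- `Λ` is homogeneous of order `α`: `Λ(vA) = v^{-α} Λ(A)` for `v > 0` and Borel sets
`A ⊆ ℝ^d ∖ {0}`. For the limit measure of a regularly varying vector this says that the vector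
has (tail) index `α`. -/
def IsHomogeneous {d : ℕ} (Λ : Measure (Fin d → ℝ)) (α : ℝ) : Prop :=
  ∀ v : ℝ, 0 < v → ∀ A : Set (Fin d → ℝ), MeasurableSet A → A ⊆ {0}ᶜ →
    Λ ((fun z => v • z) '' A) = ENNReal.ofReal (v ^ (-α)) * Λ A

end RegVar

/-! This is a multivariate form of Breiman's lemma. Write `T` for the tail of `R` and `ν` for the
measure with `ν (x, ∞) = x ^ (-α)`. Since `n * T (a n * x)` tends to `x ^ (-α)` for every `x > 0`,
the measures `n P(R / a n ∈ ·)` converge to `ν` away from the origin. For a fixed `z` this gives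
convergence of the radial integrals of `r ↦ f (r • z)`. By independence and Fubini, what remains is
to integrate this convergence over the law of `Z`.

The interchange is dominated convergence, and the moment condition pays for it. If `f` vanishes on
the ball of radius `δ`, the radial integral at `z` is at most `‖f‖` times the mass beyond `δ / (‖z‖
+ 1)`. A Potter-type bound `n * T (a n * v) ≤ 1 + K * v ^ (-p)` makes this at most a constant plus a
multiple of `(‖z‖ + 1) ^ p`. A regularly varying tail yields such a bound only for `p > α`, whence
the extra `ε`; a tail equivalent to `C * x ^ (-α)` yields it for `p = α`.

The properties of the limit follow from Tonelli on `ν ⊗ ζ`, with `ζ` the law of `Z`: homogeneity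
from a change of variable in `u`, the other properties from computing `ν` along each ray. -/

namespace RegVar

/-! ### Potter bounds and asymptotics along quantiles -/

/-- A Potter-type bound: a positive antitone function which is regularly varying with index `-α`
satisfies `T v * v ^ p ≤ K * (T u * u ^ p)` for `0 < v ≤ u` and `u` large, whenever `α < p`. -/
lemma RegularlyVaryingAtTop.exists_potter_bound {T : ℝ → ℝ} {α p : ℝ} (hT : Antitone T)
    (hpos : ∀ x, 0 < T x) (hle : ∀ x, T x ≤ 1) (hp : 0 < p) (hαp : α < p)
    (h : RegularlyVaryingAtTop T (-α)) :
    ∃ K u₀ : ℝ, 0 < K ∧ 0 < u₀ ∧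
      ∀ u, u₀ ≤ u → ∀ v, 0 < v → v ≤ u → T v * v ^ p ≤ K * (T u * u ^ p) := by
  have h2 := h (1 / 2) (by norm_num)
  have hlt : ((1 / 2 : ℝ)) ^ (-α) < 2 ^ p := by
    rw [Real.rpow_neg (by norm_num), one_div, Real.inv_rpow (by norm_num), inv_inv]
    exact Real.rpow_lt_rpow_of_exponent_lt (by norm_num) hαp
  obtain ⟨u₁, hu₁⟩ := eventually_atTop.1 (h2.eventually_lt_const hlt)
  set u₀ := max u₁ 1
  have hu₀ : 0 < u₀ := lt_of_lt_of_le one_pos (le_max_right _ _)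
  -- `T (u / 2) / T u` tends to `2 ^ α < 2 ^ p`, so halving a large `u` does not increase `T u * u ^
  -- p`.
  have step : ∀ u, u₀ ≤ u → T (u / 2) * (u / 2) ^ p ≤ T u * u ^ p := by
    intro u hu
    have h3 := (hu₁ u ((le_max_left _ _).trans hu)).le
    rw [div_le_iff₀ (hpos u), mul_one_div] at h3
    have hu' : 0 < u := hu₀.trans_le hu
    rw [Real.div_rpow hu'.le (by norm_num), ← mul_div_assoc, div_le_iff₀ (by positivity)]
    calc T (u / 2) * u ^ p ≤ (2 ^ p * T u) * u ^ p := by gcongr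
      _ = _ := by ring
  -- `K₀` compares an upper bound of `T v * v ^ p` for `v ≤ 2 * u₀` with a lower bound of `T u * u ^
  -- p` on `[u₀, 2 * u₀]`. The `2 ^ p` in `K` serves for `v` in `[u / 2, u]`.
  set K₀ := (2 * u₀) ^ p / (T (2 * u₀) * u₀ ^ p) with hK₀
  have hK₀pos : 0 < K₀ := by have := hpos (2 * u₀); positivity
  set K := max K₀ (2 ^ p)
  have hKpos : 0 < K := lt_max_of_lt_left hK₀pos
  have base : ∀ u, u₀ ≤ u → u ≤ 2 * u₀ → ∀ v, 0 < v → v ≤ u →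
      T v * v ^ p ≤ K * (T u * u ^ p) := by
    intro u hu hu2 v hv hvu
    have h4 : T (2 * u₀) * u₀ ^ p ≤ T u * u ^ p := by
      have := hT hu2
      have := (hpos u).le
      gcongr
    calc T v * v ^ p ≤ 1 * (2 * u₀) ^ p := by
          have := hle v
          have := hvu.trans hu2
          gcongr
      _ = K₀ * (T (2 * u₀) * u₀ ^ p) := by
          have := hpos (2 * u₀)
          rw [hK₀]; field_simp
      _ ≤ K * (T u * u ^ p) := by
          have : 0 < T (2 * u₀) * u₀ ^ p := by have := hpos (2 * u₀); positivity
          exact mul_le_mul (le_max_left _ _) h4 this.le hKpos.le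
  -- Dyadic descent: halve `u` until `u ≤ 2 * u₀` or `v` lies in `[u / 2, u]`.
  have ind : ∀ k : ℕ, ∀ u, u₀ ≤ u → u ≤ 2 ^ (k + 1) * u₀ → ∀ v, 0 < v → v ≤ u →
      T v * v ^ p ≤ K * (T u * u ^ p) := by
    intro k
    induction k with
    | zero => intro u hu hu2; exact base u hu (by simpa using hu2)
    | succ k ih =>
      intro u hu hu2 v hv hvu
      rcases le_total u (2 * u₀) with hc | hc
      · exact base u hu hc v hv hvu
      rcases le_total v (u / 2) with hv2 | hv2
      · refine (ih (u / 2) (by linarith) ?_ v hv hv2).trans ?_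
        · rw [pow_succ] at hu2; linarith
        · exact mul_le_mul_of_nonneg_left (step u hu) hKpos.le
      · have hu' : 0 < u := hu₀.trans_le hu
        have := hT hv2
        have := (hpos (u / 2)).le
        calc T v * v ^ p ≤ T (u / 2) * u ^ p := by gcongr
          _ = 2 ^ p * (T (u / 2) * (u / 2) ^ p) := by
            rw [Real.div_rpow hu'.le (by norm_num)]
            field_simp
          _ ≤ K * (T u * u ^ p) := by
            have h5 := step u hu
            have : 0 ≤ T (u / 2) * (u / 2) ^ p := by positivity
            exact mul_le_mul (le_max_right _ _) h5 this hKpos.le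
  refine ⟨K, u₀, hKpos, hu₀, fun u hu v hv hvu => ?_⟩
  obtain ⟨k, hk⟩ := pow_unbounded_of_one_lt (u / u₀) (one_lt_two : (1 : ℝ) < 2)
  rw [div_lt_iff₀ hu₀] at hk
  refine ind k u hu (hk.le.trans ?_) v hv hvu
  gcongr <;> norm_num

/-- The bound of `RegularlyVaryingAtTop.exists_potter_bound` holds with `p = α` for functions
equivalent to `C x ^ (-α)`. -/
lemma exists_potter_bound_of_isEquivalent {T : ℝ → ℝ} {α C : ℝ} (hle : ∀ x, T x ≤ 1)
    (hα : 0 < α) (hC : 0 < C)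
    (h : Asymptotics.IsEquivalent atTop T (fun x : ℝ => C * x ^ (-α))) :
    ∃ K u₀ : ℝ, 0 < K ∧ 0 < u₀ ∧
      ∀ u, u₀ ≤ u → ∀ v, 0 < v → v ≤ u → T v * v ^ α ≤ K * (T u * u ^ α) := by
  have hlim : Tendsto (fun x => T x * x ^ α) atTop (𝓝 C) := by
    have h1 : Asymptotics.IsEquivalent atTop (fun x => T x * x ^ α)
        (fun x => C * x ^ (-α) * x ^ α) := h.mul Asymptotics.IsEquivalent.refl
    refine (h1.congr_right ?_).tendsto_const
    filter_upwards [eventually_gt_atTop 0] with x hx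
    rw [mul_assoc, ← Real.rpow_add hx]; simp
  obtain ⟨u₁, hu₁⟩ := eventually_atTop.1
    ((hlim.eventually_lt_const (show C < 2 * C by linarith)).and
      (hlim.eventually_const_lt (show C / 2 < C by linarith)))
  set u₀ := max u₁ 1
  have hu₀ : 0 < u₀ := lt_of_lt_of_le one_pos (le_max_right _ _)
  set B := max (2 * C) (u₀ ^ α)
  have hB : 0 < B := lt_max_of_lt_left (by linarith)
  have hv : ∀ v, 0 < v → T v * v ^ α ≤ B := by
    intro v hv
    rcases le_total u₀ v with hc | hc
    · exact (hu₁ v ((le_max_left _ _).trans hc)).1.le.trans (le_max_left _ _)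
    · refine le_trans ?_ (le_max_right _ _)
      calc T v * v ^ α ≤ 1 * u₀ ^ α := by have := hle v; gcongr
        _ = _ := one_mul _
  refine ⟨B / (C / 2), u₀, by positivity, hu₀, fun u hu v hv0 _ => (hv v hv0).trans ?_⟩
  calc B = B / (C / 2) * (C / 2) := by field_simp
    _ ≤ _ := by
      have := (hu₁ u ((le_max_left _ _).trans hu)).2.le
      gcongr

lemma regularlyVaryingAtTop_of_isEquivalent {T : ℝ → ℝ} {α C : ℝ} (hC : 0 < C)
    (h : Asymptotics.IsEquivalent atTop T (fun x : ℝ => C * x ^ (-α))) :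
    RegularlyVaryingAtTop T (-α) := by
  intro x hx
  have h1 : Tendsto (fun u : ℝ => u * x) atTop atTop := tendsto_id.atTop_mul_const hx
  have h2 := (h.comp_tendsto h1).div h
  refine (h2.congr_right ?_).tendsto_const
  filter_upwards [eventually_gt_atTop 0] with u hu
  have : 0 < u ^ (-α) := by positivity
  simp only [Function.comp, Pi.div_apply, Function.const_apply]
  rw [Real.mul_rpow hu.le hx.le]
  field_simp

/-- Asymptotics of `n T(aₙ x)` when `aₙ` is the quantile sequence of the tail function `T`. -/
lemma RegularlyVaryingAtTop.tendsto_mul_apply {T : ℝ → ℝ} {α : ℝ} {a : ℕ → ℝ}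
    (h : RegularlyVaryingAtTop T (-α)) (hpos : ∀ x, 0 < T x) (ha : Tendsto a atTop atTop)
    (hle : ∀ᶠ n : ℕ in atTop, n * T (a n) ≤ 1)
    (hlt : ∀ᶠ n : ℕ in atTop, ∀ x < a n, 1 < n * T x) {x : ℝ} (hx : 0 < x) :
    Tendsto (fun n : ℕ => n * T (a n * x)) atTop (𝓝 (x ^ (-α))) := by
  -- `T` may jump at `a n`, so equality `n * T (a n) = 1` can fail. For `s < 1`, `n * T (a n * s) >
  -- 1` gives `n * T (a n) > T (a n) / T (a n * s)`, whose limit `s ^ α` is as close to `1` as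
  -- desired.
  have h1 : Tendsto (fun n : ℕ => n * T (a n)) atTop (𝓝 1) := by
    refine tendsto_order.2 ⟨fun b hb => ?_, fun b hb => hle.mono fun n hn => hn.trans_lt hb⟩
    have hc : Tendsto (fun s : ℝ => s ^ α) (𝓝[<] 1) (𝓝 1) := by
      have : ContinuousAt (fun s : ℝ => s ^ α) 1 :=
        Real.continuousAt_rpow_const _ _ (Or.inl one_ne_zero)
      have h2 := this.tendsto
      rw [Real.one_rpow] at h2
      exact h2.mono_left nhdsWithin_le_nhds
    have hs01 : ∀ᶠ s : ℝ in 𝓝[<] 1, s ∈ Set.Ioo 0 1 := Ioo_mem_nhdsLT one_pos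
    obtain ⟨s, hsb, hs0, hs1⟩ := ((hc.eventually_const_lt hb).and hs01).exists
    have h3 := ((h s hs0).comp ha).inv₀ (by positivity)
    rw [Real.rpow_neg hs0.le, inv_inv] at h3
    filter_upwards [h3.eventually_const_lt hsb, hlt, ha.eventually_gt_atTop 0] with n hn1 hn2 hn3
    refine hn1.trans ?_
    have h4 := hn2 (a n * s) (by nlinarith)
    have := hpos (a n)
    have := hpos (a n * s)
    simp only [Function.comp]
    rw [inv_div, div_lt_iff₀ (hpos _)]
    nlinarith
  have h2 := h1.mul ((h x hx).comp ha)
  rw [one_mul] at h2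
  refine h2.congr fun n => ?_
  have := (hpos (a n)).ne'
  simp only [Function.comp]
  field_simp

/-- Supplies the dominating function: the Potter bound at `u = a n` covers `v ≤ 1`, monotonicity
covers `v ≥ 1`. -/
lemma eventually_mul_apply_le {T : ℝ → ℝ} {p K u₀ : ℝ} {a : ℕ → ℝ} (hT : Antitone T)
    (hK : 0 < K) (hu₀ : 0 < u₀)
    (hb : ∀ u, u₀ ≤ u → ∀ v, 0 < v → v ≤ u → T v * v ^ p ≤ K * (T u * u ^ p))
    (ha : Tendsto a atTop atTop) (hle : ∀ᶠ n : ℕ in atTop, n * T (a n) ≤ 1) :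
    ∀ᶠ n : ℕ in atTop, ∀ v, 0 < v → n * T (a n * v) ≤ 1 + K * v ^ (-p) := by
  filter_upwards [hle, ha.eventually_ge_atTop u₀] with n hn hna v hv
  have han : 0 < a n := hu₀.trans_le hna
  rcases le_total v 1 with hv1 | hv1
  · have h1 := hb (a n) hna (a n * v) (by positivity) (by nlinarith)
    rw [Real.mul_rpow han.le hv.le] at h1
    have hap : 0 < a n ^ p := by positivity
    have hvp : 0 < v ^ p := by positivity
    have h2 : T (a n * v) ≤ K * T (a n) * v ^ (-p) := by
      rw [Real.rpow_neg hv.le, ← div_eq_mul_inv, le_div_iff₀ hvp]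
      refine le_of_mul_le_mul_right ?_ hap
      linarith
    have h3 : 0 < v ^ (-p) := by positivity
    calc n * T (a n * v) ≤ n * (K * T (a n) * v ^ (-p)) := by gcongr
      _ = K * (n * T (a n)) * v ^ (-p) := by ring
      _ ≤ K * 1 * v ^ (-p) := by gcongr
      _ ≤ _ := by linarith
  · have h1 : T (a n * v) ≤ T (a n) := hT (by nlinarith)
    have h3 : 0 < v ^ (-p) := by positivity
    have : (n : ℝ) * T (a n * v) ≤ n * T (a n) := by gcongr
    nlinarith [mul_pos hK h3]

/-! ### Generalized inverse of a distribution function -/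

section Quantile

variable {μ : Measure ℝ} {p : ℝ}

/-- Right continuity of the distribution function makes the infimum attained. -/
lemma le_cdf_sInf (hp0 : 0 < p) (hp1 : p < 1) : p ≤ cdf μ (sInf {x : ℝ | p ≤ cdf μ x}) := by
  obtain ⟨y, hy⟩ := ((tendsto_cdf_atTop μ).eventually_const_le hp1).exists
  obtain ⟨b, hb⟩ := eventually_atBot.1 ((tendsto_cdf_atBot μ).eventually_lt_const hp0)
  have hbdd : BddBelow {x : ℝ | p ≤ cdf μ x} :=
    ⟨b, fun x hx => le_of_not_ge fun h => absurd hx (not_le.2 (hb x h))⟩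
  set q := sInf {x : ℝ | p ≤ cdf μ x}
  have hc : Tendsto (cdf μ) (𝓝[>] q) (𝓝 (cdf μ q)) :=
    ((cdf μ).right_continuous q).mono_left (nhdsWithin_mono _ Set.Ioi_subset_Ici_self)
  refine ge_of_tendsto hc ?_
  filter_upwards [self_mem_nhdsWithin] with x hx
  obtain ⟨z, hz, hzx⟩ := exists_lt_of_csInf_lt ⟨y, hy⟩ hx
  exact le_trans hz (monotone_cdf μ hzx.le)

lemma cdf_lt_of_lt_sInf (hp0 : 0 < p) {x : ℝ} (hx : x < sInf {x : ℝ | p ≤ cdf μ x}) :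
    cdf μ x < p := by
  obtain ⟨b, hb⟩ := eventually_atBot.1 ((tendsto_cdf_atBot μ).eventually_lt_const hp0)
  have hbdd : BddBelow {x : ℝ | p ≤ cdf μ x} :=
    ⟨b, fun x hx => le_of_not_ge fun h => absurd hx (not_le.2 (hb x h))⟩
  by_contra! h
  exact absurd (csInf_le hbdd h) (not_le.2 hx)

end Quantile

/-! ### The tail of `R` and its quantiles -/

section Tail

variable {Ω : Type*} [MeasurableSpace Ω] (P : Measure Ω) (R : Ω → ℝ)

lemma antitone_tail : Antitone (tail P R) := fun _ _ h =>
  sub_le_sub_left (monotone_cdf _ h) _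

lemma tail_le_one (x : ℝ) : tail P R x ≤ 1 := sub_le_self _ (cdf_nonneg _ _)

lemma tail_nonneg (x : ℝ) : 0 ≤ tail P R x := sub_nonneg.2 (cdf_le_one _ _)

variable {P R}

lemma tail_pos_of_regularlyVarying {ρ : ℝ} (h : RegularlyVaryingAtTop (tail P R) ρ) (x : ℝ) :
    0 < tail P R x := by
  -- At `x = 1` the quotient is `1`, except where the tail vanishes: there it is `0 / 0 = 0`,
  -- against the limit `1`.
  have h1 := h 1 one_pos
  rw [Real.one_rpow] at h1
  obtain ⟨u, hu, hxu⟩ := ((h1.eventually_ne one_ne_zero).and (eventually_ge_atTop x)).exists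
  have h2 : tail P R u ≠ 0 := fun h0 => hu (by simp [h0])
  exact ((tail_nonneg P R u).lt_of_ne' h2).trans_le (antitone_tail P R hxu)

lemma eventually_mul_tail_quantile_le :
    ∀ᶠ n : ℕ in atTop, n * tail P R (quantile P R (1 - 1 / (n : ℝ))) ≤ 1 := by
  -- `n ≥ 2` puts the level in `(0, 1)`; at levels `1` and `0` the set under the infimum may be
  -- empty or is unbounded below.
  filter_upwards [eventually_ge_atTop 2] with n hn
  have hn' : (2 : ℝ) ≤ n := by exact_mod_cast hn
  have hn1 : 1 / (n : ℝ) < 1 := by rw [div_lt_one] <;> linarith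
  have hn0 : 0 < 1 / (n : ℝ) := by positivity
  have h := le_cdf_sInf (μ := P.map R) (sub_pos.2 hn1) (by linarith)
  have h2 : tail P R (quantile P R (1 - 1 / (n : ℝ))) ≤ 1 / n := by
    rw [tail, quantile]; linarith
  rwa [le_div_iff₀ (by linarith), mul_comm] at h2

lemma eventually_lt_mul_tail :
    ∀ᶠ n : ℕ in atTop, ∀ x < quantile P R (1 - 1 / (n : ℝ)), 1 < n * tail P R x := by
  filter_upwards [eventually_ge_atTop 2] with n hn x hx
  have hn' : (2 : ℝ) ≤ n := by exact_mod_cast hn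
  have hn1 : 1 / (n : ℝ) < 1 := by rw [div_lt_one] <;> linarith
  have h := cdf_lt_of_lt_sInf (μ := P.map R) (sub_pos.2 hn1) hx
  have h2 : 1 / n < tail P R x := by rw [tail]; linarith
  rwa [div_lt_iff₀ (by linarith), mul_comm] at h2

lemma tendsto_quantile (hpos : ∀ x, 0 < tail P R x) :
    Tendsto (fun n : ℕ => quantile P R (1 - 1 / (n : ℝ))) atTop atTop := by
  refine tendsto_atTop.2 fun b => ?_
  have h1 : Tendsto (fun n : ℕ => (n : ℝ) * tail P R b) atTop atTop :=
    tendsto_natCast_atTop_atTop.atTop_mul_const (hpos b)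
  filter_upwards [h1.eventually_gt_atTop 1,
    eventually_mul_tail_quantile_le (P := P) (R := R)] with n hn hn2
  by_contra! hlt
  have := antitone_tail P R hlt.le
  have : (n : ℝ) * tail P R b ≤ n * tail P R (quantile P R (1 - 1 / (n : ℝ))) := by gcongr
  linarith

end Tail

/-! ### From convergence of tails to convergence of integrals -/

section Convergence

/-- Probability measures on `ℝ` whose tails converge everywhere converge weakly. -/
lemma tendsto_integral_of_tendsto_tail {μ : ℕ → Measure ℝ} {ν : Measure ℝ}
    [∀ n, IsProbabilityMeasure (μ n)] [IsProbabilityMeasure ν]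
    (h : ∀ x, Tendsto (fun n => (μ n).real (Set.Ioi x)) atTop (𝓝 (ν.real (Set.Ioi x))))
    (f : BoundedContinuousFunction ℝ ℝ) :
    Tendsto (fun n => ∫ x, f x ∂(μ n)) atTop (𝓝 (∫ x, f x ∂ν)) := by
  let μ' : ℕ → ProbabilityMeasure ℝ := fun n => ⟨μ n, inferInstance⟩
  let ν' : ProbabilityMeasure ℝ := ⟨ν, inferInstance⟩
  have key : Tendsto μ' atTop (𝓝 ν') := by
    -- Weak convergence may be tested on a π-system containing small neighbourhoods of each point;
    -- the mass of `(a, b]` is a difference of tails.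
    refine (isPiSystem_Ioc (id : ℝ → ℝ) (id : ℝ → ℝ)).tendsto_probabilityMeasure_of_tendsto_of_mem
      ?_ ?_ ?_
    · rintro s ⟨a, b, -, rfl⟩
      exact measurableSet_Ioc
    · intro u hu x hx
      obtain ⟨ε, hε, hb⟩ := Metric.isOpen_iff.1 hu x hx
      refine ⟨Set.Ioc (x - ε / 2) (x + ε / 2), ⟨x - ε / 2, x + ε / 2, by simp; linarith, rfl⟩,
        Ioc_mem_nhds (by linarith) (by linarith), fun y hy => hb ?_⟩
      rw [Metric.mem_ball, Real.dist_eq, abs_lt]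
      constructor <;> linarith [hy.1, hy.2]
    · rintro s ⟨a, b, hab, rfl⟩
      have hab' : a ≤ b := le_of_lt hab
      have hioc : ∀ m : Measure ℝ, IsFiniteMeasure m →
          m.real (Set.Ioc a b) = m.real (Set.Ioi a) - m.real (Set.Ioi b) := by
        intro m _
        rw [← Set.Ioi_sdiff_Ioi, measureReal_sdiff (Set.Ioi_subset_Ioi hab') measurableSet_Ioi]
      have h1 : Tendsto (fun n => (μ n).real (Set.Ioc a b)) atTop (𝓝 (ν.real (Set.Ioc a b))) := by
        simp_rw [fun n => hioc (μ n) inferInstance, hioc ν inferInstance]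
        exact (h a).sub (h b)
      exact NNReal.tendsto_coe.1 h1
  exact ProbabilityMeasure.tendsto_iff_forall_integral_tendsto.1 key f

lemma integral_cond_Ioi {μ : Measure ℝ} {c : ℝ} {f : ℝ → ℝ} (hf : ∀ x ≤ c, f x = 0)
    (h0 : μ (Set.Ioi c) ≠ 0) (h1 : μ (Set.Ioi c) ≠ ⊤) :
    ∫ x, f x ∂μ = μ.real (Set.Ioi c) * ∫ x, f x ∂(μ[|Set.Ioi c]) := by
  have h2 : μ.real (Set.Ioi c) ≠ 0 := (ENNReal.toReal_ne_zero).2 ⟨h0, h1⟩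
  rw [ProbabilityTheory.cond, integral_smul_measure, ENNReal.toReal_inv, smul_eq_mul,
    ← measureReal_def, ← mul_assoc, mul_inv_cancel₀ h2, one_mul,
    setIntegral_eq_integral_of_forall_compl_eq_zero]
  intro x hx
  exact hf x (not_lt.1 hx)

/-- Convergence of the tails on `[c, ∞)` gives the convergence of the integrals of bounded
continuous functions that vanish on `(-∞, c]`. -/
lemma tendsto_integral_of_tendsto_tail_Ioi {μ : ℕ → Measure ℝ} {ν : Measure ℝ} {c : ℝ}
    [∀ n, IsFiniteMeasure (μ n)] (h0 : ν (Set.Ioi c) ≠ 0) (h1 : ν (Set.Ioi c) ≠ ⊤)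
    (h : ∀ x, c ≤ x → Tendsto (fun n => (μ n).real (Set.Ioi x)) atTop (𝓝 (ν.real (Set.Ioi x))))
    (f : BoundedContinuousFunction ℝ ℝ) (hf : ∀ x ≤ c, f x = 0) :
    Tendsto (fun n => ∫ x, f x ∂(μ n)) atTop (𝓝 (∫ x, f x ∂ν)) := by
  have h2 : ν.real (Set.Ioi c) ≠ 0 := (ENNReal.toReal_ne_zero).2 ⟨h0, h1⟩
  -- Conditioning on `(c, ∞)` reduces to probability measures. It makes sense only for large `n`,
  -- once the masses, which have a nonzero limit, are themselves nonzero.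
  obtain ⟨m, hm⟩ := eventually_atTop.1 ((h c le_rfl).eventually_ne h2)
  rw [← tendsto_add_atTop_iff_nat m]
  have hμ0 : ∀ n, (μ (n + m)) (Set.Ioi c) ≠ 0 := fun n h3 =>
    hm (n + m) (Nat.le_add_left _ _) (by simp [measureReal_def, h3])
  have : ∀ n, IsProbabilityMeasure ((μ (n + m))[|Set.Ioi c]) := fun n =>
    cond_isProbabilityMeasure (hμ0 n)
  have : IsProbabilityMeasure (ν[|Set.Ioi c]) := cond_isProbabilityMeasure_of_finite h0 h1
  have hreal : ∀ (m : Measure ℝ) (x : ℝ), (m[|Set.Ioi c]).real (Set.Ioi x) =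
      (m.real (Set.Ioi c))⁻¹ * m.real (Set.Ioi (max c x)) := by
    intro m x
    rw [measureReal_def, cond_apply measurableSet_Ioi, Set.Ioi_inter_Ioi, ENNReal.toReal_mul,
      ENNReal.toReal_inv]
    rfl
  rw [integral_cond_Ioi hf h0 h1]
  simp_rw [fun n => integral_cond_Ioi (μ := μ (n + m)) hf (hμ0 n) (measure_ne_top _ _)]
  have hshift : ∀ x, c ≤ x → Tendsto (fun n => (μ (n + m)).real (Set.Ioi x)) atTop
      (𝓝 (ν.real (Set.Ioi x))) := fun x hx => (tendsto_add_atTop_iff_nat m).2 (h x hx)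
  refine (hshift c le_rfl).mul (tendsto_integral_of_tendsto_tail (fun x => ?_) f)
  simp_rw [hreal]
  exact ((hshift c le_rfl).inv₀ h2).mul (hshift _ (le_max_left _ _))

end Convergence

/-! ### The radial measure and the limit measure -/

/-- The measure `α u ^ (-α - 1) du` on `(0, ∞)`. -/
noncomputable def powerMeasure (α : ℝ) : Measure ℝ :=
  (volume.restrict (Set.Ioi 0)).withDensity fun u => ENNReal.ofReal (α * u ^ (-α - 1))

/-- The image of `powerMeasure α ⊗ ζ` under `(u, z) ↦ u z`, as a measure on `ℝ^d ∖ {0}`. -/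
noncomputable def limitMeasure {d : ℕ} (α : ℝ) (ζ : Measure (Fin d → ℝ)) :
    Measure (Fin d → ℝ) :=
  (((powerMeasure α).prod ζ).map fun p => p.1 • p.2).restrict {0}ᶜ

section PowerMeasure

variable {α : ℝ}

instance : SigmaFinite (powerMeasure α) :=
  SigmaFinite.withDensity_of_ne_top (by simp)

lemma measurable_powerDensity :
    Measurable fun u : ℝ => ENNReal.ofReal (α * u ^ (-α - 1)) := by
  fun_prop

lemma lintegral_powerMeasure {g : ℝ → ENNReal} (hg : Measurable g) :
    ∫⁻ u, g u ∂(powerMeasure α) =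
      ∫⁻ u in Set.Ioi 0, g u * ENNReal.ofReal (α * u ^ (-α - 1)) := by
  rw [powerMeasure, lintegral_withDensity_eq_lintegral_mul _ measurable_powerDensity hg]
  exact lintegral_congr fun u => mul_comm _ _

lemma powerMeasure_Ioi (hα : 0 < α) {c : ℝ} (hc : 0 < c) :
    powerMeasure α (Set.Ioi c) = ENNReal.ofReal (c ^ (-α)) := by
  rw [powerMeasure, withDensity_apply _ measurableSet_Ioi, Measure.restrict_restrict
    measurableSet_Ioi, Set.inter_eq_left.2 (Set.Ioi_subset_Ioi hc.le),
    ← ofReal_integral_eq_lintegral_ofReal]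
  · rw [integral_const_mul, integral_Ioi_rpow_of_lt (by linarith) hc]
    congr 1
    rw [sub_add_cancel]
    field_simp
  · exact (integrableOn_Ioi_rpow_of_lt (by linarith) hc).const_mul α
  · filter_upwards [ae_restrict_mem measurableSet_Ioi] with u hu
    have : 0 < u := hc.trans hu
    positivity

lemma powerMeasure_Iic_zero : powerMeasure α (Set.Iic 0) = 0 := by
  refine withDensity_absolutelyContinuous _ _ ?_
  rw [Measure.restrict_apply measurableSet_Iic, Set.Iic_inter_Ioi, Set.Ioc_self, measure_empty]

/-- Source of the value `∞` when some `x i = 0 < z i`. -/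
lemma powerMeasure_Ioi_zero (hα : 0 < α) : powerMeasure α (Set.Ioi 0) = ⊤ := by
  have h : Tendsto (fun c : ℝ => c ^ (-α)) (𝓝[>] 0) atTop :=
    tendsto_rpow_neg_nhdsGT_zero (by linarith)
  refine top_le_iff.1 (le_of_tendsto (ENNReal.tendsto_ofReal_atTop.comp h) ?_)
  filter_upwards [self_mem_nhdsWithin] with c hc
  rw [Function.comp, ← powerMeasure_Ioi hα hc]
  exact measure_mono (Set.Ioi_subset_Ioi (le_of_lt hc))

lemma powerMeasure_congr {s t : Set ℝ} (h : ∀ u, 0 < u → (u ∈ s ↔ u ∈ t)) :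
    powerMeasure α s = powerMeasure α t := by
  refine measure_congr ?_
  have h0 : ∀ᵐ u ∂(powerMeasure α), 0 < u := by
    rw [ae_iff]
    simpa [Set.Iic] using powerMeasure_Iic_zero (α := α)
  filter_upwards [h0] with u hu
  exact propext (h u hu)

/-- `ν {u > 0 | u t > x} = (t / x) ^ α` in `[0, ∞]`. -/
lemma powerMeasure_lt_mul (hα : 0 < α) {t x : ℝ} (ht : 0 ≤ t) (hx : 0 ≤ x) :
    powerMeasure α {u | 0 < u ∧ x < u * t} = (ENNReal.ofReal t / ENNReal.ofReal x) ^ α := by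
  rcases ht.eq_or_lt with rfl | ht
  · simp [hα, not_lt.2 hx]
  rcases hx.eq_or_lt with rfl | hx
  · have : {u : ℝ | 0 < u ∧ 0 < u * t} = Set.Ioi 0 := by
      ext u; simp only [Set.mem_ofPred_eq, Set.mem_Ioi, and_iff_left_iff_imp]
      intro hu; positivity
    rw [this, powerMeasure_Ioi_zero hα, ENNReal.ofReal_zero, ENNReal.div_zero (by simpa using ht),
      ENNReal.top_rpow_of_pos hα]
  · have : {u : ℝ | 0 < u ∧ x < u * t} = Set.Ioi (x / t) := by
      ext u
      simp only [Set.mem_ofPred_eq, Set.mem_Ioi, div_lt_iff₀ ht, and_iff_right_iff_imp]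
      intro h
      exact pos_of_mul_pos_left (hx.trans h) ht.le
    rw [this, powerMeasure_Ioi hα (by positivity), ← ENNReal.ofReal_div_of_pos hx,
      ENNReal.ofReal_rpow_of_pos (by positivity), Real.rpow_neg (by positivity),
      ← Real.inv_rpow (by positivity), inv_div]

/-- The sets attached to the coordinates are upper sets of the line, hence nested, so the measure of
their union is the supremum of their measures. -/
lemma powerMeasure_exists_lt_mul (hα : 0 < α) {d : ℕ} {z x : Fin d → ℝ} (hz : ∀ i, 0 ≤ z i)
    (hx : ∀ i, 0 ≤ x i) :
    powerMeasure α {u | ∃ i, 0 < u ∧ x i < u * z i} =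
      ⨆ i, (ENNReal.ofReal (z i) / ENNReal.ofReal (x i)) ^ α := by
  have hU : ∀ i, IsUpperSet {u : ℝ | 0 < u ∧ x i < u * z i} := fun i u v huv hu =>
    ⟨hu.1.trans_le huv, hu.2.trans_le (mul_le_mul_of_nonneg_right huv (hz i))⟩
  have hD : Directed (· ⊆ ·) fun i => {u : ℝ | 0 < u ∧ x i < u * z i} := fun i j =>
    ((hU i).total (hU j)).elim (fun h => ⟨j, h, subset_rfl⟩) fun h => ⟨i, subset_rfl, h⟩
  rw [Set.ofPred_exists, hD.measure_iUnion]
  simp_rw [fun i => powerMeasure_lt_mul hα (hz i) (hx i)]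

end PowerMeasure

/-! ### Properties of the limit measure -/

section LimitMeasure

variable {d : ℕ} {α : ℝ} {ζ : Measure (Fin d → ℝ)} {A : Set (Fin d → ℝ)}

lemma measurable_smul_prod : Measurable fun p : ℝ × (Fin d → ℝ) => p.1 • p.2 := by
  fun_prop

lemma limitMeasure_apply (hA : MeasurableSet A) (hA0 : A ⊆ {0}ᶜ) :
    limitMeasure α ζ A = ((powerMeasure α).prod ζ) {p | p.1 • p.2 ∈ A} := by
  rw [limitMeasure, Measure.restrict_apply hA, Set.inter_eq_left.2 hA0,
    Measure.map_apply measurable_smul_prod hA]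
  rfl

variable [IsProbabilityMeasure ζ]

lemma limitMeasure_eq_lintegral (hA : MeasurableSet A) (hA0 : A ⊆ {0}ᶜ) :
    limitMeasure α ζ A =
      ∫⁻ u in Set.Ioi 0, ζ {z | u • z ∈ A} * ENNReal.ofReal (α * u ^ (-α - 1)) := by
  have hm : MeasurableSet {p : ℝ × (Fin d → ℝ) | p.1 • p.2 ∈ A} := measurable_smul_prod hA
  rw [limitMeasure_apply hA hA0, Measure.prod_apply hm]
  exact lintegral_powerMeasure (measurable_measure_prodMk_left hm)

lemma limitMeasure_eq_lintegral_symm (hA : MeasurableSet A) (hA0 : A ⊆ {0}ᶜ) :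
    limitMeasure α ζ A = ∫⁻ z, powerMeasure α {u | u • z ∈ A} ∂ζ := by
  have hm : MeasurableSet {p : ℝ × (Fin d → ℝ) | p.1 • p.2 ∈ A} := measurable_smul_prod hA
  rw [limitMeasure_apply hA hA0, Measure.prod_apply_symm hm]
  rfl

/-- Substituting `v * u` for `u` turns the density into `v * (v * u) ^ (-α - 1) = v ^ (-α) * u ^ (-α
- 1)`. -/
lemma isHomogeneous_limitMeasure (hα : 0 < α) : IsHomogeneous (limitMeasure α ζ) α := by
  intro v hv A hA hA0
  have himg : (fun z : Fin d → ℝ => v • z) '' A = (fun z => v⁻¹ • z) ⁻¹' A := by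
    ext z
    constructor
    · rintro ⟨w, hw, rfl⟩
      simpa [smul_smul, hv.ne'] using hw
    · intro hz
      exact ⟨v⁻¹ • z, hz, by simp [smul_smul, hv.ne']⟩
  have hmeas : MeasurableSet ((fun z : Fin d → ℝ => v • z) '' A) := by
    rw [himg]
    exact (measurable_const_smul v⁻¹) hA
  have h0 : (fun z : Fin d → ℝ => v • z) '' A ⊆ {0}ᶜ := by
    rintro _ ⟨w, hw, rfl⟩
    simpa [hv.ne'] using hA0 hw
  have hIoi : (fun u : ℝ => v * u) '' Set.Ioi 0 = Set.Ioi 0 := by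
    rw [Set.image_mul_left_Ioi hv, mul_zero]
  rw [limitMeasure_eq_lintegral hmeas h0, limitMeasure_eq_lintegral hA hA0, ← hIoi,
    lintegral_image_eq_lintegral_abs_deriv_mul (f := fun u => v * u)
      (f' := fun _ => v) measurableSet_Ioi
      (fun x _ => ((hasDerivAt_id x).const_mul v).hasDerivWithinAt.congr_deriv (mul_one v))
      (mul_right_injective₀ hv.ne').injOn, hIoi, ← lintegral_const_mul' _ _ ENNReal.ofReal_ne_top]
  refine setLIntegral_congr_fun measurableSet_Ioi fun u hu => ?_
  have hu' : (0 : ℝ) < u := hu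
  have hset : {z : Fin d → ℝ | (v * u) • z ∈ (fun z => v • z) '' A} = {z | u • z ∈ A} := by
    ext z
    rw [himg]
    simp [smul_smul, hv.ne']
  have hd : ENNReal.ofReal |v| * ENNReal.ofReal (α * (v * u) ^ (-α - 1)) =
      ENNReal.ofReal (v ^ (-α)) * ENNReal.ofReal (α * u ^ (-α - 1)) := by
    rw [← ENNReal.ofReal_mul (abs_nonneg v), ← ENNReal.ofReal_mul (by positivity), abs_of_pos hv,
      Real.mul_rpow hv.le hu'.le, Real.rpow_sub_one hv.ne']
    congr 1
    field_simp
  simp only [hset]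
  rw [mul_left_comm, hd, mul_left_comm]

lemma limitMeasure_ne_zero (hα : 0 < α) (h : ¬ ∀ᵐ z ∂ζ, z = 0) : limitMeasure α ζ ≠ 0 := by
  intro h0
  apply h
  have h1 := limitMeasure_eq_lintegral_symm (α := α) (ζ := ζ) (A := {0}ᶜ)
    (measurableSet_singleton _).compl subset_rfl
  have hm : Measurable fun z : Fin d → ℝ =>
      powerMeasure α {u | u • z ∈ ({0}ᶜ : Set (Fin d → ℝ))} :=
    measurable_measure_prodMk_right (measurable_smul_prod (measurableSet_singleton _).compl)
  rw [h0, Measure.coe_zero, Pi.zero_apply, eq_comm,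
    lintegral_eq_zero_iff hm] at h1
  filter_upwards [h1] with z hz
  by_contra hz0
  have h2 : powerMeasure α (Set.Ioi 1) ≤ powerMeasure α {u | u • z ∈ ({0}ᶜ : Set (Fin d → ℝ))} := by
    refine measure_mono fun u hu => ?_
    have : (0 : ℝ) < u := one_pos.trans hu
    simp [this.ne', hz0]
  rw [powerMeasure_Ioi hα one_pos, Real.one_rpow] at h2
  rw [Pi.zero_apply] at hz
  rw [hz] at h2
  simp at h2

lemma isM0_limitMeasure (hα : 0 < α) (hint : Integrable (fun z => ‖z‖ ^ α) ζ) :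
    IsM0 (limitMeasure α ζ) := by
  refine ⟨by simp [limitMeasure], fun O hO h0 => ?_⟩
  obtain ⟨δ, hδ, hb⟩ := Metric.isOpen_iff.1 hO 0 h0
  rw [limitMeasure_eq_lintegral_symm hO.measurableSet.compl
    (Set.compl_subset_compl.2 (Set.singleton_subset_iff.2 h0))]
  -- Leaving the `δ`-ball forces `u * ‖z‖ > δ / 2`; halving `δ` yields the strict inequality of
  -- `powerMeasure_lt_mul`.
  have hle : ∀ z, powerMeasure α {u | u • z ∈ Oᶜ} ≤
      ENNReal.ofReal ((2 / δ) ^ α * ‖z‖ ^ α) := by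
    intro z
    rw [← Real.mul_rpow (by positivity) (by positivity),
      ← ENNReal.ofReal_rpow_of_nonneg (by positivity) hα.le]
    have h3 := powerMeasure_lt_mul hα (norm_nonneg z) (half_pos hδ).le
    rw [← ENNReal.ofReal_div_of_pos (by positivity),
      show ‖z‖ / (δ / 2) = 2 / δ * ‖z‖ by field_simp] at h3
    rw [← h3, powerMeasure_congr (t := {u | u • z ∈ Oᶜ} ∩ Set.Ioi 0)
      fun u hu => by simp [hu]]
    refine measure_mono fun u hu => ⟨hu.2, ?_⟩
    by_contra! hlt
    refine hu.1 (hb ?_)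
    have hu0 : (0 : ℝ) < u := hu.2
    rw [mem_ball_zero_iff, norm_smul, Real.norm_eq_abs, abs_of_pos hu0]
    linarith
  refine (lintegral_mono hle).trans_lt ?_
  exact (hint.const_mul _).lintegral_lt_top

lemma limitMeasure_compl_nonneg (h : ∀ᵐ z ∂ζ, ∀ i, 0 ≤ z i) :
    limitMeasure α ζ {z | ∀ i, 0 ≤ z i}ᶜ = 0 := by
  have hm : MeasurableSet {z : Fin d → ℝ | ∀ i, 0 ≤ z i} := by
    simp only [Set.ofPred_forall]
    exact MeasurableSet.iInter fun i => measurableSet_le measurable_const (measurable_pi_apply i)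
  rw [limitMeasure_eq_lintegral_symm hm.compl
    (Set.compl_subset_compl.2 (by simp)), lintegral_congr_ae (g := fun _ => 0), lintegral_zero]
  filter_upwards [h] with z hz
  rw [powerMeasure_congr (t := ∅), measure_empty]
  intro u hu
  simp only [Set.mem_ofPred_eq, Set.mem_compl_iff, Set.mem_empty_iff_false, iff_false, not_not]
  exact fun i => mul_nonneg hu.le (hz i)

lemma limitMeasure_nonneg_diff_Icc (hα : 0 < α) (h : ∀ᵐ z ∂ζ, ∀ i, 0 ≤ z i) {x : Fin d → ℝ}
    (hx : ∀ i, 0 ≤ x i) :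
    limitMeasure α ζ ({z | ∀ i, 0 ≤ z i} \ Set.Icc 0 x) =
      ∫⁻ z, ⨆ i, (ENNReal.ofReal (z i) / ENNReal.ofReal (x i)) ^ α ∂ζ := by
  have hm : MeasurableSet {z : Fin d → ℝ | ∀ i, 0 ≤ z i} := by
    simp only [Set.ofPred_forall]
    exact MeasurableSet.iInter fun i => measurableSet_le measurable_const (measurable_pi_apply i)
  rw [limitMeasure_eq_lintegral_symm (hm.diff measurableSet_Icc)]
  · refine lintegral_congr_ae ?_
    filter_upwards [h] with z hz
    rw [← powerMeasure_exists_lt_mul hα hz hx]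
    refine powerMeasure_congr fun u hu => ?_
    have h1 : ∀ i, 0 ≤ u * z i := fun i => mul_nonneg hu.le (hz i)
    simp [Pi.le_def, hu, h1]
  · rintro z ⟨-, hz⟩ rfl
    exact hz ⟨le_rfl, hx⟩

end LimitMeasure

/-! ### Comparison of norms and of moments -/

lemma _root_.Seminorm.exists_norm_le_mul {d : ℕ} (N : Seminorm ℝ (Fin d → ℝ))
    (hN : ∀ z, N z = 0 → z = 0) : ∃ C : ℝ, 0 < C ∧ ∀ z, ‖z‖ ≤ C * N z := by
  have hc : Continuous N := by
    rw [← continuousOn_univ]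
    exact N.convexOn.continuousOn isOpen_univ
  -- The sphere is empty when `d = 0`; otherwise `N` has a positive minimum on it by compactness.
  rcases (Metric.sphere (0 : Fin d → ℝ) 1).eq_empty_or_nonempty with he | hne
  · refine ⟨1, one_pos, fun z => ?_⟩
    by_cases hz : z = 0
    · simp [hz]
    · have : ‖z‖⁻¹ • z ∈ Metric.sphere (0 : Fin d → ℝ) 1 := by
        simp [norm_smul, hz]
      simp [he] at this
  · obtain ⟨w, hw, hmin⟩ := (isCompact_sphere (0 : Fin d → ℝ) 1).exists_isMinOn hne hc.continuousOn
    have hw0 : 0 < N w := (apply_nonneg N w).lt_of_ne' fun h => by simp [hN w h] at hw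
    refine ⟨(N w)⁻¹, inv_pos.2 hw0, fun z => ?_⟩
    by_cases hz : z = 0
    · simp [hz]
    · have hz' : 0 < ‖z‖ := norm_pos_iff.2 hz
      have h1 : ‖z‖⁻¹ • z ∈ Metric.sphere (0 : Fin d → ℝ) 1 := by
        simp [norm_smul, hz]
      have h2 : N w ≤ N (‖z‖⁻¹ • z) := hmin h1
      rw [map_smul_eq_mul, norm_inv, norm_norm, inv_mul_eq_div, le_div_iff₀ hz'] at h2
      rw [inv_mul_eq_div, le_div_iff₀ hw0]
      linarith

lemma integrable_norm_rpow_of_le {d : ℕ} {ζ : Measure (Fin d → ℝ)} [IsFiniteMeasure ζ] {p q : ℝ}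
    (hp : 0 ≤ p) (hpq : p ≤ q) (h : Integrable (fun z => ‖z‖ ^ q) ζ) :
    Integrable (fun z => ‖z‖ ^ p) ζ := by
  refine ((integrable_const 1).add h).mono' (by fun_prop) (ae_of_all _ fun z => ?_)
  have h0 : 0 ≤ ‖z‖ ^ q := by positivity
  rw [Real.norm_of_nonneg (by positivity), Pi.add_apply]
  rcases le_total ‖z‖ 1 with h1 | h1
  · linarith [Real.rpow_le_one (norm_nonneg z) h1 hp]
  · linarith [Real.rpow_le_rpow_of_exponent_le h1 hpq]

lemma integrable_norm_add_one_rpow {d : ℕ} {ζ : Measure (Fin d → ℝ)} [IsFiniteMeasure ζ] {p : ℝ}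
    (hp : 0 ≤ p) (h : Integrable (fun z => ‖z‖ ^ p) ζ) :
    Integrable (fun z => (‖z‖ + 1) ^ p) ζ := by
  refine (((integrable_const 1).add h).const_mul (2 ^ p)).mono' (by fun_prop)
    (ae_of_all _ fun z => ?_)
  have h0 : 0 ≤ ‖z‖ ^ p := by positivity
  have h2 : (0 : ℝ) < 2 ^ p := by positivity
  rw [Real.norm_of_nonneg (by positivity), Pi.add_apply]
  rcases le_total ‖z‖ 1 with h1 | h1
  · have : (‖z‖ + 1) ^ p ≤ 2 ^ p := Real.rpow_le_rpow (by positivity) (by linarith) hp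
    nlinarith [mul_nonneg h2.le h0]
  · have : (‖z‖ + 1) ^ p ≤ (2 * ‖z‖) ^ p := Real.rpow_le_rpow (by positivity) (by linarith) hp
    rw [Real.mul_rpow (by norm_num) (by positivity)] at this
    linarith

/-! ### Scaled laws and disintegration -/

section Scaling

variable {Ω : Type*} [MeasurableSpace Ω] {P : Measure Ω} [IsProbabilityMeasure P] {d : ℕ}
  {R : Ω → ℝ} {Z : Ω → Fin d → ℝ}

lemma isM0_scaledLaw (X : Ω → Fin d → ℝ) (n : ℕ) (a : ℝ) : IsM0 (scaledLaw P X n a) where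
  zero := by simp [scaledLaw]
  finite O _ _ := by
    rw [scaledLaw, Measure.smul_apply, smul_eq_mul]
    exact ENNReal.mul_lt_top (ENNReal.natCast_lt_top n) (measure_lt_top _ _)

/-- The measure `n P(R / a ∈ ·)` on `ℝ`. -/
noncomputable def scaledRadialLaw (P : Measure Ω) (R : Ω → ℝ) (n : ℕ) (a : ℝ) : Measure ℝ :=
  (n : ENNReal) • P.map fun ω => a⁻¹ * R ω

instance (n : ℕ) (a : ℝ) : IsFiniteMeasure (scaledRadialLaw P R n a) := by
  unfold scaledRadialLaw
  refine ⟨?_⟩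
  rw [Measure.smul_apply, smul_eq_mul]
  exact ENNReal.mul_lt_top (ENNReal.natCast_lt_top n) (measure_lt_top _ _)

lemma scaledRadialLaw_real_Ioi (hR : Measurable R) (n : ℕ) {a : ℝ} (ha : 0 < a) (x : ℝ) :
    (scaledRadialLaw P R n a).real (Set.Ioi x) = n * tail P R (a * x) := by
  have : IsProbabilityMeasure (P.map R) := Measure.isProbabilityMeasure_map hR.aemeasurable
  rw [tail, cdf_eq_real, ← probReal_compl_eq_one_sub measurableSet_Iic, Set.compl_Iic,
    map_measureReal_apply hR measurableSet_Ioi, scaledRadialLaw, measureReal_ennreal_smul_apply,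
    map_measureReal_apply (by fun_prop) measurableSet_Ioi, ENNReal.toReal_natCast]
  congr 2
  ext ω
  simp only [Set.mem_preimage, Set.mem_Ioi]
  rw [inv_mul_eq_div, lt_div_iff₀' ha]

/-- The cutoff `max r 0` changes nothing almost surely, but makes the radial integrand vanish for
negative `r` too, as convergence of tails requires. -/
lemma integral_scaledLaw (hR : Measurable R) (hZ : Measurable Z) (hR0 : ∀ᵐ ω ∂P, 0 ≤ R ω)
    (hRZ : IndepFun R Z P) (f : BoundedContinuousFunction (Fin d → ℝ) ℝ) (hf : f 0 = 0)
    (n : ℕ) {a : ℝ} (ha : 0 < a) :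
    ∫ x, f x ∂(scaledLaw P (fun ω => R ω • Z ω) n a) =
      ∫ z, ∫ r, f (max r 0 • z) ∂(scaledRadialLaw P R n a) ∂(P.map Z) := by
  have hmeas : Measurable fun ω => a⁻¹ • R ω • Z ω := by fun_prop
  have : IsProbabilityMeasure (P.map R) := Measure.isProbabilityMeasure_map hR.aemeasurable
  have : IsProbabilityMeasure (P.map Z) := Measure.isProbabilityMeasure_map hZ.aemeasurable
  have hg : Continuous fun p : ℝ × (Fin d → ℝ) => f (max (a⁻¹ * p.1) 0 • p.2) := by fun_prop
  have hgi : Integrable (fun p : ℝ × (Fin d → ℝ) => f (max (a⁻¹ * p.1) 0 • p.2))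
      ((P.map R).prod (P.map Z)) :=
    Integrable.of_bound hg.aestronglyMeasurable ‖f‖ (ae_of_all _ fun p => f.norm_coe_le_norm _)
  rw [scaledLaw, integral_smul_measure, setIntegral_eq_integral_of_forall_compl_eq_zero
    (fun x hx => by rw [not_not.1 hx]; exact hf),
    integral_map hmeas.aemeasurable f.continuous.aestronglyMeasurable]
  have h1 : ∫ ω, f (a⁻¹ • R ω • Z ω) ∂P =
      ∫ p, f (max (a⁻¹ * p.1) 0 • p.2) ∂((P.map R).prod (P.map Z)) := by
    rw [← (indepFun_iff_map_prod_eq_prod_map_map hR.aemeasurable hZ.aemeasurable).1 hRZ,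
      integral_map (by fun_prop) hg.aestronglyMeasurable]
    refine integral_congr_ae ?_
    filter_upwards [hR0] with ω hω
    simp only [smul_smul]
    rw [max_eq_left (by positivity)]
  rw [h1, integral_prod_symm _ hgi, smul_eq_mul, ← integral_const_mul]
  congr 1 with z
  have hc : Continuous fun r : ℝ => f (max r 0 • z) := by fun_prop
  rw [scaledRadialLaw, integral_smul_measure, smul_eq_mul,
    integral_map (by fun_prop) hc.aestronglyMeasurable,
    integral_map (by fun_prop) (by fun_prop)]

end Scaling

lemma integral_limitMeasure {d : ℕ} {α : ℝ} {ζ : Measure (Fin d → ℝ)} [IsProbabilityMeasure ζ]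
    (h0 : IsM0 (limitMeasure α ζ)) (f : BoundedContinuousFunction (Fin d → ℝ) ℝ) {δ : ℝ}
    (hδ : 0 < δ) (hf : ∀ z, ‖z‖ < δ → f z = 0) :
    ∫ x, f x ∂(limitMeasure α ζ) = ∫ z, ∫ u, f (max u 0 • z) ∂(powerMeasure α) ∂ζ := by
  have hf0 : f 0 = 0 := hf 0 (by simpa using hδ)
  have hm : MeasurableSet {p : ℝ × (Fin d → ℝ) | p.1 • p.2 ∈ (Metric.ball 0 δ)ᶜ} :=
    measurable_smul_prod measurableSet_ball.compl
  have hc : Continuous fun p : ℝ × (Fin d → ℝ) => f (p.1 • p.2) := by fun_prop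
  -- The product measure is infinite; Fubini applies because `f (u • z)` is bounded and supported in
  -- this set of finite measure.
  have hfin : ((powerMeasure α).prod ζ) {p | p.1 • p.2 ∈ (Metric.ball 0 δ)ᶜ} ≠ ⊤ := by
    rw [← limitMeasure_apply measurableSet_ball.compl
      (Set.compl_subset_compl.2 (Set.singleton_subset_iff.2 (Metric.mem_ball_self hδ)))]
    exact (h0.finite _ Metric.isOpen_ball (Metric.mem_ball_self hδ)).ne
  have hi : Integrable (fun p : ℝ × (Fin d → ℝ) => f (p.1 • p.2)) ((powerMeasure α).prod ζ) := by
    refine (Measure.integrableOn_of_bounded hfin hc.aestronglyMeasurable (M := ‖f‖)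
      (ae_of_all _ fun p => f.norm_coe_le_norm _)).integrable_of_forall_notMem_eq_zero
      fun p hp => hf _ ?_
    simpa using hp
  rw [limitMeasure, setIntegral_eq_integral_of_forall_compl_eq_zero
    (fun x hx => by rw [not_not.1 hx]; exact hf0),
    integral_map measurable_smul_prod.aemeasurable f.continuous.aestronglyMeasurable,
    integral_prod_symm _ hi]
  have hpos : ∀ᵐ u ∂(powerMeasure α), 0 < u := by
    rw [ae_iff]
    simpa [Set.Iic] using powerMeasure_Iic_zero (α := α)
  congr 1 with z
  refine integral_congr_ae ?_
  filter_upwards [hpos] with u hu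
  rw [max_eq_left hu.le]

/-! ### The convergence theorem -/

/-- The `M₀`-convergence of `n P(aₙ⁻¹ R Z ∈ ·)`, given the convergence of `n P(R > aₙ x)` and a
dominating moment of `Z`. -/
lemma tendstoM0_scaledLaw {Ω : Type*} [MeasurableSpace Ω] {P : Measure Ω} [IsProbabilityMeasure P]
    {d : ℕ} {R : Ω → ℝ} {Z : Ω → Fin d → ℝ} {a : ℕ → ℝ} {α p K : ℝ}
    (hR : Measurable R) (hZ : Measurable Z) (hR0 : ∀ᵐ ω ∂P, 0 ≤ R ω) (hRZ : IndepFun R Z P)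
    (hα : 0 < α) (hαp : α ≤ p) (hZp : Integrable (fun z => ‖z‖ ^ p) (P.map Z))
    (ha : Tendsto a atTop atTop)
    (hlim : ∀ x : ℝ, 0 < x → Tendsto (fun n : ℕ => n * tail P R (a n * x)) atTop (𝓝 (x ^ (-α))))
    (hbd : ∀ᶠ n : ℕ in atTop, ∀ x, 0 < x → n * tail P R (a n * x) ≤ 1 + K * x ^ (-p)) :
    TendstoM0 (fun n : ℕ => scaledLaw P (fun ω => R ω • Z ω) n (a n))
      (limitMeasure α (P.map Z)) := by
  have : IsProbabilityMeasure (P.map Z) := Measure.isProbabilityMeasure_map hZ.aemeasurable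
  have hp : 0 < p := hα.trans_le hαp
  have hM0 : IsM0 (limitMeasure α (P.map Z)) :=
    isM0_limitMeasure hα (integrable_norm_rpow_of_le hα.le hαp hZp)
  refine ⟨fun n => isM0_scaledLaw _ _ _, hM0, fun f hf => ?_⟩
  obtain ⟨δ, hδ, hball⟩ := Metric.eventually_nhds_iff.1 hf
  have hfδ : ∀ z, ‖z‖ < δ → f z = 0 := fun z hz => hball (by simpa using hz)
  -- The `+ 1` keeps the threshold finite and positive at `z = 0`.
  have hvanish : ∀ z : Fin d → ℝ, ∀ r ≤ δ / (‖z‖ + 1), f (max r 0 • z) = 0 := by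
    intro z r hr
    refine hfδ _ ?_
    have hz : 0 < ‖z‖ + 1 := by positivity
    have h1 : max r 0 ≤ δ / (‖z‖ + 1) := max_le hr (by positivity)
    rw [norm_smul, Real.norm_of_nonneg (le_max_right _ _)]
    calc max r 0 * ‖z‖ ≤ δ / (‖z‖ + 1) * ‖z‖ := by gcongr
      _ = δ * ‖z‖ / (‖z‖ + 1) := by ring
      _ < δ := by rw [div_lt_iff₀ hz]; nlinarith
  rw [integral_limitMeasure hM0 f hδ hfδ]
  have hev : ∀ᶠ n in atTop, 0 < a n := ha.eventually_gt_atTop 0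
  have hcongr : (fun n => ∫ z, ∫ r, f (max r 0 • z) ∂(scaledRadialLaw P R n (a n)) ∂(P.map Z))
      =ᶠ[atTop] fun n => ∫ x, f x ∂(scaledLaw P (fun ω => R ω • Z ω) n (a n)) := by
    filter_upwards [hev] with n hn
    rw [integral_scaledLaw hR hZ hR0 hRZ f (hfδ 0 (by simpa using hδ)) n hn]
  refine Tendsto.congr' hcongr ?_
  -- The dominating function is `‖f‖` times the bound `hbd` at `x = δ / (‖z‖ + 1)`.
  refine tendsto_integral_filter_of_dominated_convergence
    (fun z => ‖f‖ * (1 + K * ((‖z‖ + 1) ^ p * (δ ^ p)⁻¹))) ?_ ?_ ?_ ?_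
  · refine Eventually.of_forall fun n => ?_
    have hc : Continuous fun q : ℝ × (Fin d → ℝ) => f (max q.1 0 • q.2) := by fun_prop
    exact (hc.stronglyMeasurable.integral_prod_left'
      (μ := scaledRadialLaw P R n (a n))).aestronglyMeasurable
  · filter_upwards [hev, hbd] with n hn hb
    refine ae_of_all _ fun z => ?_
    have hc : 0 < δ / (‖z‖ + 1) := by positivity
    rw [← setIntegral_eq_integral_of_forall_compl_eq_zero (s := Set.Ioi (δ / (‖z‖ + 1)))
      (fun r hr => hvanish z r (not_lt.1 hr))]
    refine (norm_setIntegral_le_of_norm_le_const (measure_lt_top _ _)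
      fun r _ => f.norm_coe_le_norm _).trans ?_
    rw [scaledRadialLaw_real_Ioi hR n hn]
    refine mul_le_mul_of_nonneg_left ((hb _ hc).trans_eq ?_) (norm_nonneg f)
    rw [Real.rpow_neg hc.le, ← Real.inv_rpow hc.le, inv_div, Real.div_rpow (by positivity) hδ.le,
      div_eq_mul_inv]
  · have := integrable_norm_add_one_rpow hp.le hZp
    exact ((integrable_const 1).add ((this.mul_const _).const_mul K)).const_mul _
  · refine ae_of_all _ fun z => ?_
    have hc : 0 < δ / (‖z‖ + 1) := by positivity
    have h1 := powerMeasure_Ioi hα hc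
    let g : BoundedContinuousFunction ℝ ℝ :=
      f.compContinuous ⟨fun r => max r 0 • z, by fun_prop⟩
    have hpc : 0 < (δ / (‖z‖ + 1)) ^ (-α) := by positivity
    refine tendsto_integral_of_tendsto_tail_Ioi (c := δ / (‖z‖ + 1))
      (by rw [h1]; simpa using hpc) (by rw [h1]; exact ENNReal.ofReal_ne_top)
      (fun x hx => ?_) g (hvanish z)
    have hx0 : 0 < x := hc.trans_le hx
    rw [measureReal_def, powerMeasure_Ioi hα hx0, ENNReal.toReal_ofReal (by positivity)]
    refine (hlim x hx0).congr' ?_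
    filter_upwards [hev] with n hn
    rw [scaledRadialLaw_real_Ioi hR n hn]

/-- Under either tail condition the tail of `R` is regularly varying and satisfies a Potter-type
bound whose exponent is a finite moment of `Z`. -/
lemma exists_moment_potter_bound {Ω : Type*} [MeasurableSpace Ω] {P : Measure Ω}
    [IsProbabilityMeasure P] {d : ℕ} {R : Ω → ℝ} {Z : Ω → Fin d → ℝ} (hZ : Measurable Z)
    (N : Seminorm ℝ (Fin d → ℝ)) (hN : ∀ z, N z = 0 → z = 0) {α : ℝ} (hα : 0 < α)
    (h : (RegularlyVaryingAtTop (tail P R) (-α) ∧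
            ∃ ε : ℝ, 0 < ε ∧ Integrable (fun ω => N (Z ω) ^ (α + ε)) P) ∨
         ((∃ C : ℝ, 0 < C ∧
              Asymptotics.IsEquivalent atTop (tail P R) (fun x : ℝ => C * x ^ (-α))) ∧
            Integrable (fun ω => N (Z ω) ^ α) P)) :
    RegularlyVaryingAtTop (tail P R) (-α) ∧ ∃ p K u₀ : ℝ, α ≤ p ∧ 0 < K ∧ 0 < u₀ ∧
      Integrable (fun z => ‖z‖ ^ p) (P.map Z) ∧
      ∀ u, u₀ ≤ u → ∀ v, 0 < v → v ≤ u → tail P R v * v ^ p ≤ K * (tail P R u * u ^ p) := by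
  obtain ⟨c, hc, hcN⟩ := N.exists_norm_le_mul hN
  have hmom : ∀ p : ℝ, 0 < p → Integrable (fun ω => N (Z ω) ^ p) P →
      Integrable (fun z => ‖z‖ ^ p) (P.map Z) := by
    intro p hp hi
    rw [integrable_map_measure (Measurable.aestronglyMeasurable (by fun_prop)) hZ.aemeasurable]
    refine (hi.const_mul (c ^ p)).mono'
      (Measurable.aestronglyMeasurable (by fun_prop)) (ae_of_all _ fun ω => ?_)
    rw [Function.comp, Real.norm_of_nonneg (by positivity),
      ← Real.mul_rpow hc.le (apply_nonneg N _)]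
    exact Real.rpow_le_rpow (norm_nonneg _) (hcN _) hp.le
  rcases h with ⟨hrv, ε, hε, hi⟩ | ⟨⟨C, hC, heq⟩, hi⟩
  · obtain ⟨K, u₀, hK, hu₀, hb⟩ := hrv.exists_potter_bound (p := α + ε) (antitone_tail P R)
      (tail_pos_of_regularlyVarying hrv) (tail_le_one P R) (by linarith) (by linarith)
    exact ⟨hrv, α + ε, K, u₀, by linarith, hK, hu₀, hmom _ (by linarith) hi, hb⟩
  · obtain ⟨K, u₀, hK, hu₀, hb⟩ := exists_potter_bound_of_isEquivalent (tail_le_one P R) hα hC heq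
    exact ⟨regularlyVaryingAtTop_of_isEquivalent hC heq, α, K, u₀, le_rfl, hK, hu₀,
      hmom _ hα hi, hb⟩

end RegVar

theorem mainTheorem3 {Ω : Type*} [MeasurableSpace Ω] (P : Measure Ω) [IsProbabilityMeasure P]
    {d : ℕ} (R : Ω → ℝ) (Z : Ω → Fin d → ℝ)
    (hR : Measurable R) (hZ : Measurable Z)
    (hR_nonneg : ∀ᵐ ω ∂P, 0 ≤ R ω) (hRZ : IndepFun R Z P)
    -- an arbitrary norm on `ℝ^d`
    (N : Seminorm ℝ (Fin d → ℝ)) (hN : ∀ z, N z = 0 → z = 0)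
    (α : ℝ) (hα : 0 < α)
    (h : (RegVar.RegularlyVaryingAtTop (RegVar.tail P R) (-α) ∧
            ∃ ε : ℝ, 0 < ε ∧ Integrable (fun ω => N (Z ω) ^ (α + ε)) P) ∨
         ((∃ C : ℝ, 0 < C ∧
              Asymptotics.IsEquivalent atTop (RegVar.tail P R) (fun x : ℝ => C * x ^ (-α))) ∧
            Integrable (fun ω => N (Z ω) ^ α) P)) :
    ∃ Λ : Measure (Fin d → ℝ),
      Tendsto (fun n : ℕ => RegVar.quantile P R (1 - 1 / (n : ℝ))) atTop atTop ∧
      RegVar.TendstoM0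
        (fun n : ℕ => RegVar.scaledLaw P (fun ω => R ω • Z ω) n
          (RegVar.quantile P R (1 - 1 / (n : ℝ)))) Λ ∧
      -- the limit is non-zero as soon as `Z` is not almost surely zero
      (¬ (∀ᵐ ω ∂P, Z ω = 0) →
        RegVar.IsRegularlyVarying P (fun ω => R ω • Z ω)
          (fun n : ℕ => RegVar.quantile P R (1 - 1 / (n : ℝ))) Λ) ∧
      RegVar.IsHomogeneous Λ α ∧
      (∀ A : Set (Fin d → ℝ), MeasurableSet A → A ⊆ {0}ᶜ →
        Λ A = ∫⁻ u in Set.Ioi (0 : ℝ),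
          P {ω | u • Z ω ∈ A} * ENNReal.ofReal (α * u ^ (-α - 1))) ∧
      ((∀ᵐ ω ∂P, ∀ i, 0 ≤ Z ω i) →
        Λ {z | ∀ i, 0 ≤ z i}ᶜ = 0 ∧
        -- division in `[0, ∞]`: `t / 0 = ∞` for `t > 0` and `0 / 0 = 0`
        ∀ x : Fin d → ℝ, (∀ i, 0 ≤ x i) → x ≠ 0 →
          Λ ({z | ∀ i, 0 ≤ z i} \ Set.Icc 0 x) =
            ∫⁻ ω, ⨆ i, (ENNReal.ofReal (Z ω i) / ENNReal.ofReal (x i)) ^ α ∂P) := by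
  have hμ : IsProbabilityMeasure (P.map Z) := Measure.isProbabilityMeasure_map hZ.aemeasurable
  obtain ⟨hrv, p, K, u₀, hαp, hK, hu₀, hint, hb⟩ := RegVar.exists_moment_potter_bound hZ N hN hα h
  have hpos := RegVar.tail_pos_of_regularlyVarying hrv
  have ha := RegVar.tendsto_quantile hpos
  have hle := RegVar.eventually_mul_tail_quantile_le (P := P) (R := R)
  have hM0 := RegVar.tendstoM0_scaledLaw hR hZ hR_nonneg hRZ hα hαp hint ha
    (fun x hx => hrv.tendsto_mul_apply hpos ha hle RegVar.eventually_lt_mul_tail hx)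
    (RegVar.eventually_mul_apply_le (RegVar.antitone_tail P R) hK hu₀ hb ha hle)
  refine ⟨RegVar.limitMeasure α (P.map Z), ha, hM0, fun hZ0 => ⟨ha, hM0, ?_⟩,
    RegVar.isHomogeneous_limitMeasure hα, fun A hA hA0 => ?_, fun hZn => ?_⟩
  · refine RegVar.limitMeasure_ne_zero hα fun h0 => hZ0 ?_
    exact ae_of_ae_map hZ.aemeasurable h0
  · rw [RegVar.limitMeasure_eq_lintegral hA hA0]
    congr 1 with u
    rw [Measure.map_apply hZ (show MeasurableSet {z : Fin d → ℝ | u • z ∈ A} from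
      measurable_const_smul u hA)]
    rfl
  · have hm : MeasurableSet {z : Fin d → ℝ | ∀ i, 0 ≤ z i} := by
      simp only [Set.ofPred_forall]
      exact MeasurableSet.iInter fun i => measurableSet_le measurable_const (measurable_pi_apply i)
    have hζ : ∀ᵐ z ∂(P.map Z), ∀ i, 0 ≤ z i := (ae_map_iff hZ.aemeasurable hm).2 hZn
    refine ⟨RegVar.limitMeasure_compl_nonneg hζ, fun x hx _ => ?_⟩
    rw [RegVar.limitMeasure_nonneg_diff_Icc hα hζ hx, lintegral_map (by fun_prop) hZ]
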